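/- Let $(\Omega,\Sigma,\mu)$ be a $\sigma$-finite measure space and let $P\colon\Omega\to(0,\infty]$ be measurable (a variable exponent). For $p\in(0,\infty)$ put $\Phi_p(t)=t^p$, and put $\Phi_\infty(t)=0$ if $0\le t\le 1$ and $\Phi_\infty(t)=\infty$ if $t>1$. For measurable $f\colon\Omega\to\mathbb F$ (with $\mathbb F=\mathbb R$ or $\mathbb C$) let $\rho_P(f)=\int_\Omega \Phi_{P(\omega)}(|f(\omega)|)\,d\mu(\omega)$. The variable exponent Lebesgue space $L_P=L_P(\mu)$ consists of all (classes modulo equality a.e. of) measurable $f$ with $\rho_P(tf)<\infty$ for some $t\in(0,\infty)$, and is equipped with $\|f\|_P=\inf\{t\in(0,\infty):\rho_P(f/t)<1\}$. The essential range $R(P)\subseteq[0,\infty]$ of $P$ is the support of the image measure of $\mu$ under $P$, that is, the set of all $p\in[0,\infty]$ such that $\mu(P^{-1}(V))>0$ for every neighbourhood $V$ of $p$; let $P^-=\min R(P)$ (with $P^-=\infty$ if $\mu=0$). Assume that $P^->0$, and let $q\in(0,\infty]$. A sequence $(x_n)_{n=1}^\infty$ in $L_P$ is disjointly supported if $\mu(\{x_n\ne0\}\cap\{x_m\neq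 0\})=0$ whenever $n\ne m$, and it is equivalent to the unit vector system $(e_n)_{n=1}^\infty$ of $\ell_q$ if there are constants $c,C\in(0,\infty)$ such that $$c\,\Big\|\sum_n a_n e_n\Big\|_{\ell_q}\le\Big\|\sum_n a_n x_n\Big\|_{P}\le C\,\Big\|\sum_n a_n e_n\Big\|_{\ell_q}$$ for every finitely supported scalar sequence $(a_n)_{n=1}^\infty$. (i) If $L_P$ has a disjointly supported sequence equivalent to the unit vector system of $\ell_q$, then $q\in R(P)$. (ii) If moreover $\mu$ is nonatomic (every measurable set of positive measure is a disjoint union of two measurable sets of positive measure), then $L_P$ has a disjointly supported sequence equivalent to the unit vector system of $\ell_q$ if and only if $q\in R(P)$. -/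

import Mathlib

open MeasureTheory Function
open scoped ENNReal NNReal

noncomputable section

namespace VarLebesgue

/-- A variable exponent on `Ω`: a measurable function `P : Ω → (0, ∞]`. -/
structure VariableExponent (Ω : Type*) [MeasurableSpace Ω] where
  toFun : Ω → ℝ≥0∞
  measurable : Measurable toFun
  pos : ∀ ω, 0 < toFun ω

/-- The potential function `Φ_p(t) = t ^ p` for `p ∈ (0, ∞)`, with `Φ_∞ = ∞ · χ_(1, ∞]`. -/
def potential (p t : ℝ≥0∞) : ℝ≥0∞ :=
  if p = ∞ then (if t ≤ 1 then 0 else ∞) else t ^ p.toReal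

theorem potential_zero {p : ℝ≥0∞} (hp : 0 < p) : potential p 0 = 0 := by
  unfold potential
  split_ifs with h h'
  · rfl
  · simp at h'
  · exact ENNReal.zero_rpow_of_pos (ENNReal.toReal_pos hp.ne' h)

theorem potential_mono (p : ℝ≥0∞) : Monotone (potential p) := by
  intro s t hst
  unfold potential
  split_ifs with h h1 h2 h2
  · exact le_rfl
  · exact zero_le
  · exact absurd (hst.trans h2) h1
  · exact le_rfl
  · exact ENNReal.rpow_le_rpow hst ENNReal.toReal_nonneg

theorem potential_measurable : Measurable (fun z : ℝ≥0∞ × ℝ≥0∞ => potential z.1 z.2) := by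
  unfold potential
  refine Measurable.ite (measurable_fst (measurableSet_singleton _)) ?_ ?_
  · exact Measurable.ite (measurable_snd measurableSet_Iic) measurable_const measurable_const
  · exact measurable_snd.pow measurable_fst.ennreal_toReal

variable {Ω : Type*} [MeasurableSpace Ω]

/-- The modular `ρ_P(f) = ∫ Φ_{P(ω)}(f(ω)) dμ(ω)` of a function `f : Ω → [0, ∞]`. -/
def modular (P : VariableExponent Ω) (μ : Measure Ω) (f : Ω → ℝ≥0∞) : ℝ≥0∞ :=
  ∫⁻ ω, potential (P.toFun ω) (f ω) ∂μ

/-- The Luxemburg gauge `inf {t ∈ (0, ∞) : ρ_P(f / t) < 1}` of a function `f : Ω → [0, ∞]`. -/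
def luxemburg (P : VariableExponent Ω) (μ : Measure Ω) (f : Ω → ℝ≥0∞) : ℝ≥0∞ :=
  sInf {t : ℝ≥0∞ | 0 < t ∧ t < ∞ ∧ modular P μ (fun ω => f ω / t) < 1}

/-- The essential range `R(P)`: the support of the image measure `P(μ)` on `[0, ∞]`. -/
def essentialRange (P : VariableExponent Ω) (μ : Measure Ω) : Set ℝ≥0∞ :=
  (μ.map P.toFun).support

/-- `P⁻`, the least element of the essential range. -/
def lowerExponent (P : VariableExponent Ω) (μ : Measure Ω) : ℝ≥0∞ :=
  sInf (essentialRange P μ)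

theorem modular_mono (P : VariableExponent Ω) (μ : Measure Ω) {f g : Ω → ℝ≥0∞}
    (h : ∀ᵐ ω ∂μ, f ω ≤ g ω) : modular P μ f ≤ modular P μ g :=
  lintegral_mono_ae (h.mono fun _ hω => potential_mono _ hω)

theorem modular_sup_le (P : VariableExponent Ω) (μ : Measure Ω) {f g : Ω → ℝ≥0∞}
    (hf : AEMeasurable f μ) :
    modular P μ (fun ω => max (f ω) (g ω)) ≤ modular P μ f + modular P μ g := by
  have hm : AEMeasurable (fun ω => potential (P.toFun ω) (f ω)) μ :=
    potential_measurable.comp_aemeasurable (P.measurable.aemeasurable.prodMk hf)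
  unfold modular
  rw [← lintegral_add_left' hm]
  refine lintegral_mono fun ω => ?_
  rcases le_total (f ω) (g ω) with h | h
  · simp only [max_eq_right h]
    exact le_add_self
  · simp only [max_eq_left h]
    exact le_self_add

/-- The variable exponent Lebesgue space `L_P(μ)`: all classes of scalar measurable functions
`f` with `ρ_P(t |f|) < ∞` for some `t ∈ (0, ∞)`. -/
def VarLp (𝕜 : Type*) [RCLike 𝕜] (P : VariableExponent Ω) (μ : Measure Ω) :
    Submodule 𝕜 (Ω →ₘ[μ] 𝕜) where
  carrier := {f | ∃ t : ℝ≥0, 0 < t ∧ modular P μ (fun ω => (t : ℝ≥0∞) * ‖f ω‖ₑ) < ∞}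
  zero_mem' := by
    refine ⟨1, one_pos, ?_⟩
    have h : ∀ᵐ ω ∂μ, ((1 : ℝ≥0) : ℝ≥0∞) * ‖(0 : Ω →ₘ[μ] 𝕜) ω‖ₑ ≤ 0 := by
      filter_upwards [AEEqFun.coeFn_zero (μ := μ) (β := 𝕜) (α := Ω)] with ω hω
      simp [hω]
    refine (modular_mono P μ h).trans_lt ?_
    simp [modular, potential_zero (P.pos _)]
  add_mem' := by
    rintro f g ⟨s, hs, hf⟩ ⟨t, ht, hg⟩
    refine ⟨min s t / 2, by positivity, ?_⟩
    have hm : AEMeasurable (fun ω => (s : ℝ≥0∞) * ‖f ω‖ₑ) μ :=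
      f.aestronglyMeasurable.enorm.const_mul _
    refine lt_of_le_of_lt (modular_mono P μ ?_)
      ((modular_sup_le P μ (g := fun ω => (t : ℝ≥0∞) * ‖g ω‖ₑ) hm).trans_lt
        (ENNReal.add_lt_top.2 ⟨hf, hg⟩))
    filter_upwards [AEEqFun.coeFn_add f g] with ω hω
    rw [hω, Pi.add_apply]
    have key : (min s t / 2) * ‖f ω + g ω‖₊ ≤ max (s * ‖f ω‖₊) (t * ‖g ω‖₊) := by
      have h1 : min s t * ‖f ω‖₊ ≤ max (s * ‖f ω‖₊) (t * ‖g ω‖₊) :=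
        (mul_le_mul_left (min_le_left _ _) _).trans (le_max_left _ _)
      have h2 : min s t * ‖g ω‖₊ ≤ max (s * ‖f ω‖₊) (t * ‖g ω‖₊) :=
        (mul_le_mul_left (min_le_right _ _) _).trans (le_max_right _ _)
      calc (min s t / 2) * ‖f ω + g ω‖₊ ≤ (min s t / 2) * (‖f ω‖₊ + ‖g ω‖₊) := by
            gcongr; exact nnnorm_add_le _ _
        _ = (min s t * ‖f ω‖₊ + min s t * ‖g ω‖₊) / 2 := by ring
        _ ≤ (max (s * ‖f ω‖₊) (t * ‖g ω‖₊) + max (s * ‖f ω‖₊) (t * ‖g ω‖₊)) / 2 := by gcongr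
        _ = max (s * ‖f ω‖₊) (t * ‖g ω‖₊) := by
            rw [← two_mul]
            exact mul_div_cancel_left₀ _ two_ne_zero
    simp only [enorm_eq_nnnorm]
    exact_mod_cast key
  smul_mem' := by
    rintro c f ⟨t, ht, hf⟩
    refine ⟨t / (‖c‖₊ + 1), by positivity, ?_⟩
    refine lt_of_le_of_lt (modular_mono P μ ?_) hf
    filter_upwards [AEEqFun.coeFn_smul c f] with ω hω
    rw [hω, Pi.smul_apply]
    have key : t / (‖c‖₊ + 1) * ‖c • f ω‖₊ ≤ t * ‖f ω‖₊ := by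
      rw [nnnorm_smul, ← mul_assoc]
      gcongr
      rw [div_mul_eq_mul_div]
      refine div_le_of_le_mul₀ (by positivity) (by positivity) ?_
      gcongr
      exact le_self_add
    simp only [enorm_eq_nnnorm]
    exact_mod_cast key

/-- The quasi-norm `‖f‖_P = inf {t ∈ (0, ∞) : ρ_P(|f| / t) < 1}` of `L_P(μ)`. -/
instance VarLp.instNorm (𝕜 : Type*) [RCLike 𝕜] (P : VariableExponent Ω) (μ : Measure Ω) :
    Norm (VarLp 𝕜 P μ) where
  norm f := (luxemburg P μ fun ω => ‖(f : Ω →ₘ[μ] 𝕜) ω‖ₑ).toReal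

/-- If `P⁻ > 0`, the Luxemburg gauge is finite on `L_P(μ)`. -/
theorem luxemburg_lt_top {𝕜 : Type*} [RCLike 𝕜] {P : VariableExponent Ω} {μ : Measure Ω}
    (hP : 0 < lowerExponent P μ) (f : VarLp 𝕜 P μ) :
    (luxemburg P μ fun ω => ‖(f : Ω →ₘ[μ] 𝕜) ω‖ₑ) < ∞ := by
  obtain ⟨f, t, ht, hf⟩ := f
  obtain ⟨r, hr0, hr⟩ := ENNReal.lt_iff_exists_nnreal_btwn.1 hP
  have hr0' : 0 < r := by exact_mod_cast hr0
  have hae : ∀ᵐ ω ∂μ, (r : ℝ≥0∞) ≤ P.toFun ω := by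
    have h1 : ∀ᵐ p ∂(μ.map P.toFun), p ∈ (μ.map P.toFun).support :=
      Measure.support_mem_ae
    filter_upwards [ae_of_ae_map P.measurable.aemeasurable h1] with ω hω
    exact hr.le.trans (sInf_le hω)
  set A := modular P μ (fun ω => (t : ℝ≥0∞) * ‖f ω‖ₑ) with hA
  obtain ⟨s, hs0, hs1, hs⟩ : ∃ s : ℝ≥0, 0 < s ∧ s ≤ 1 ∧ s ^ (r : ℝ) * A.toNNReal < 1 := by
    have hlim : Filter.Tendsto (fun s : ℝ≥0 => s ^ (r : ℝ) * A.toNNReal) (nhds 0) (nhds 0) := by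
      have h := ((NNReal.continuous_rpow_const (y := (r : ℝ)) r.coe_nonneg).tendsto 0).mul_const A.toNNReal
      rwa [NNReal.zero_rpow (by exact_mod_cast hr0'.ne'), zero_mul] at h
    have h1 := hlim.eventually (gt_mem_nhds (zero_lt_one (α := ℝ≥0)))
    have h2 : ∀ᶠ s : ℝ≥0 in nhds 0, s < 1 := gt_mem_nhds one_pos
    obtain ⟨s, hs, hs0⟩ := (((h1.and h2).filter_mono nhdsWithin_le_nhds).and
      (self_mem_nhdsWithin (s := Set.Ioi (0 : ℝ≥0)))).exists
    exact ⟨s, hs0, hs.2.le, hs.1⟩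
  have hst : 0 < s * t := mul_pos hs0 ht
  refine lt_of_le_of_lt (sInf_le (a := (((s * t)⁻¹ : ℝ≥0) : ℝ≥0∞)) ⟨?_, ENNReal.coe_lt_top, ?_⟩)
    ENNReal.coe_lt_top
  · exact_mod_cast inv_pos.2 hst
  have hle : modular P μ (fun ω => ‖f ω‖ₑ / (((s * t)⁻¹ : ℝ≥0) : ℝ≥0∞)) ≤
      (s : ℝ≥0∞) ^ (r : ℝ) * A := by
    rw [hA, modular, modular, ← lintegral_const_mul' _ _
      (ENNReal.rpow_ne_top_of_nonneg r.coe_nonneg ENNReal.coe_ne_top)]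
    refine lintegral_mono_ae ?_
    filter_upwards [hae] with ω hω
    have e : ‖f ω‖ₑ / (((s * t)⁻¹ : ℝ≥0) : ℝ≥0∞) = s * (t * ‖f ω‖ₑ) := by
      rw [ENNReal.coe_inv hst.ne', div_eq_mul_inv, inv_inv, ENNReal.coe_mul]; ring
    rw [e]
    have hs1' : (s : ℝ≥0∞) ≤ 1 := by exact_mod_cast hs1
    unfold potential
    split_ifs with h h1 h2 h2
    · exact zero_le
    · exact zero_le
    · exact absurd ((mul_le_of_le_one_left zero_le hs1').trans h2) h1
    · rw [ENNReal.mul_top]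
      exact (ENNReal.rpow_pos (by exact_mod_cast hs0) ENNReal.coe_ne_top).ne'
    · rw [ENNReal.mul_rpow_of_nonneg _ _ ENNReal.toReal_nonneg]
      gcongr ?_ * _
      refine ENNReal.rpow_le_rpow_of_exponent_ge hs1' ?_
      simpa using ENNReal.toReal_mono h hω
  refine hle.trans_lt ?_
  rw [← ENNReal.coe_toNNReal hf.ne, ← ENNReal.coe_rpow_of_nonneg _ r.coe_nonneg]
  exact_mod_cast hs

/-- A sequence in `L_P(μ)` is disjointly supported if its terms have pairwise disjoint supports,
up to null sets. -/
def DisjointlySupported {𝕜 : Type*} [RCLike 𝕜] {P : VariableExponent Ω} {μ : Measure Ω}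
    (x : ℕ → VarLp 𝕜 P μ) : Prop :=
  Pairwise (AEDisjoint μ on fun n => support ((x n : Ω →ₘ[μ] 𝕜) : Ω → 𝕜))

/-- Two sequences in quasi-normed spaces are equivalent if the norms of their finite linear
combinations with the same coefficients are comparable, uniformly in the coefficients. -/
def EquivalentSequences (𝕜 : Type*) [RCLike 𝕜] {X Y : Type*} [AddCommGroup X] [Module 𝕜 X] [Norm X]
    [AddCommGroup Y] [Module 𝕜 Y] [Norm Y] (x : ℕ → X) (y : ℕ → Y) : Prop :=
  ∃ c C : ℝ, 0 < c ∧ 0 < C ∧ ∀ a : ℕ →₀ 𝕜,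
    c * ‖a.sum fun n t => t • y n‖ ≤ ‖a.sum fun n t => t • x n‖ ∧
      ‖a.sum fun n t => t • x n‖ ≤ C * ‖a.sum fun n t => t • y n‖

/-- The unit vector system of `ℓ_q`. -/
def unitVector (𝕜 : Type*) [RCLike 𝕜] (q : ℝ≥0∞) (n : ℕ) : lp (fun _ : ℕ => 𝕜) q :=
  lp.single q n (1 : 𝕜)

/-- An atom: a measurable set of positive measure that cannot be split into two measurable
sets of positive measure. -/
def IsMeasureAtom (μ : Measure Ω) (A : Set Ω) : Prop :=
  MeasurableSet A ∧ 0 < μ A ∧ ∀ B ⊆ A, MeasurableSet B → μ B = 0 ∨ μ (A \ B) = 0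

/-- A measure is nonatomic if it has no atoms. -/
def IsNonatomic (μ : Measure Ω) : Prop :=
  ∀ A, ¬ IsMeasureAtom μ A

end VarLebesgue

end

/-!
Since `Φ_p (t / M ^ (1 / p)) = Φ_p t / M`, with `1 / ∞ = 0`, and since the modular is additive on
disjointly supported functions, a sum of `N` of them with modulars bounded below grows at least like
`N ^ (1 / p)` where `P ≤ p`, and at most like `N ^ (1 / p)` where `P ≥ p`. If `q ∉ R(P)`, then `P`
avoids an interval `(p, p')` around `q`. For a sequence equivalent to the basis of `ℓ_q`, the lower
growth makes the parts on `{P ≤ q}` tend to `0` in modular, so after passing to suitable terms the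
sums grow only like `N ^ (1 / p')`, which is slower than `N ^ (1 / q)`. For `q = ∞` there is no
other part, and the terms themselves would tend to `0`.

Conversely, near `q ∈ R(P)` a nonatomic measure leaves room for disjoint sets `E n` of positive
finite measure on which `P` approaches `q` as fast as we like. The modular of `b • x n`, with `x n`
the indicator of `E n` normalized by `μ(E n) ^ (-1 / P)`, is the average of `Φ_P |b|` over `E n`.
This differs from `Φ_q |b|` by a summable error as long as `|b| ≤ 1 / 2`, where `Φ_p` depends
continuously on `p`, even at `p = ∞`.
-/

namespace VarLebesgue

open Filter Topology

section Potential

variable {p q t c M : ℝ≥0∞}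

theorem potential_top (t : ℝ≥0∞) : potential ∞ t = if t ≤ 1 then 0 else ∞ :=
  if_pos rfl

theorem potential_of_ne_top (hp : p ≠ ∞) (t : ℝ≥0∞) : potential p t = t ^ p.toReal :=
  if_neg hp

theorem potential_le_iff (hp : 0 < p) (hc : c ≠ ∞) :
    potential p t ≤ c ↔ t ≤ c ^ p.toReal⁻¹ := by
  rcases eq_or_ne p ∞ with rfl | hp'
  · rw [potential_top, ENNReal.toReal_top, inv_zero, ENNReal.rpow_zero]
    split_ifs with h <;> simp [h, hc]
  · rw [potential_of_ne_top hp', ENNReal.le_rpow_inv_iff (ENNReal.toReal_pos hp.ne' hp')]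

theorem potential_div_rpow_inv (hp : 0 < p) (hM : M ≠ ∞) :
    potential p (t / M ^ p.toReal⁻¹) = potential p t / M := by
  rcases eq_or_ne p ∞ with rfl | hp'
  · rw [ENNReal.toReal_top, inv_zero, ENNReal.rpow_zero, div_one, potential_top]
    split_ifs <;> simp [ENNReal.top_div, hM]
  · rw [potential_of_ne_top hp', potential_of_ne_top hp',
      ENNReal.div_rpow_of_nonneg _ _ ENNReal.toReal_nonneg,
      ENNReal.rpow_inv_rpow (ENNReal.toReal_pos hp.ne' hp').ne']

theorem toReal_inv_anti (hp : 0 < p) (hpq : p ≤ q) : q.toReal⁻¹ ≤ p.toReal⁻¹ := by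
  rw [← ENNReal.toReal_inv, ← ENNReal.toReal_inv]
  exact ENNReal.toReal_mono (ENNReal.inv_ne_top.2 hp.ne') (ENNReal.inv_le_inv.2 hpq)

theorem toReal_inv_strictAnti (hp : 0 < p) (hpq : p < q) : q.toReal⁻¹ < p.toReal⁻¹ := by
  rw [← ENNReal.toReal_inv, ← ENNReal.toReal_inv]
  exact ENNReal.toReal_strict_mono (ENNReal.inv_ne_top.2 hp.ne') (ENNReal.inv_lt_inv.2 hpq)

theorem potential_div_rpow_inv_le (hp : 0 < p) (hpq : p ≤ q) (hM : 1 ≤ M) (hM' : M ≠ ∞) :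
    potential q (t / M ^ p.toReal⁻¹) ≤ potential q t / M := by
  rw [← potential_div_rpow_inv (hp.trans_le hpq) hM']
  exact potential_mono q (ENNReal.div_le_div_left
    (ENNReal.rpow_le_rpow_of_exponent_le hM (toReal_inv_anti hp hpq)) t)

theorem le_potential_div_rpow_inv (hp : 0 < p) (hpq : p ≤ q) (hM : 1 ≤ M) (hM' : M ≠ ∞) :
    potential p t / M ≤ potential p (t / M ^ q.toReal⁻¹) := by
  rw [← potential_div_rpow_inv hp hM']
  exact potential_mono p (ENNReal.div_le_div_left
    (ENNReal.rpow_le_rpow_of_exponent_le hM (toReal_inv_anti hp hpq)) t)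

theorem continuousAt_potential (hq : 0 < q) {y : ℝ≥0∞} (hy : y < 1) :
    ContinuousAt (fun z : ℝ≥0∞ × ℝ≥0∞ => potential z.1 z.2) (q, y) := by
  rcases eq_or_ne q ∞ with rfl | hq'
  · have h0 : potential ∞ y = 0 := (potential_top y).trans (if_pos hy.le)
    rw [ContinuousAt, h0, ENNReal.tendsto_nhds_zero]
    intro d hd
    obtain ⟨c, hyc, hc⟩ := exists_between hy
    obtain ⟨n, hn⟩ := ((ENNReal.tendsto_pow_atTop_nhds_zero_of_lt_one hc).eventually
      (ge_mem_nhds hd)).exists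
    filter_upwards [prod_mem_nhds (Ioi_mem_nhds (ENNReal.natCast_lt_top n)) (Iio_mem_nhds hyc)]
      with ⟨p, u⟩ ⟨hp, hu⟩
    simp only [Set.mem_Ioi, Set.mem_Iio] at hp hu
    rcases eq_or_ne p ∞ with rfl | hp'
    · simp [potential_top, (hu.trans hc).le]
    · calc potential p u = u ^ p.toReal := potential_of_ne_top hp' u
        _ ≤ u ^ (n : ℝ) := ENNReal.rpow_le_rpow_of_exponent_ge (hu.trans hc).le
            (by simpa using ENNReal.toReal_mono hp' hp.le)
        _ ≤ c ^ n := by rw [ENNReal.rpow_natCast]; gcongr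
        _ ≤ d := hn
  · have hpair : Tendsto (fun z : ℝ≥0∞ × ℝ≥0∞ => (z.2.toNNReal, z.1.toReal)) (𝓝 (q, y))
        (𝓝 (y.toNNReal, q.toReal)) :=
      ((ENNReal.tendsto_toNNReal hy.ne_top).comp (continuous_snd.tendsto (q, y))).prodMk_nhds
        ((ENNReal.tendsto_toReal hq').comp (continuous_fst.tendsto (q, y)))
    have hrpow : ContinuousAt (fun z : ℝ≥0∞ × ℝ≥0∞ => z.2.toNNReal ^ z.1.toReal) (q, y) :=
      (NNReal.continuousAt_rpow (.inr (ENNReal.toReal_pos hq.ne' hq'))).tendsto.comp hpair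
    refine (ENNReal.continuous_coe.continuousAt.comp hrpow).congr ?_
    filter_upwards [prod_mem_nhds (isOpen_ne.mem_nhds hq') (Iio_mem_nhds hy)]
      with ⟨p, u⟩ ⟨hp, hu⟩
    rw [potential_of_ne_top hp, Function.comp_apply,
      ENNReal.coe_rpow_of_nonneg _ ENNReal.toReal_nonneg, ENNReal.coe_toNNReal]
    exact (lt_top_of_lt hu).ne

theorem eventually_potential_le_add {d : ℝ≥0∞} (hq : 0 < q) (hd : d ≠ 0) :
    ∀ᶠ p in 𝓝 q, ∀ y ≤ (1 / 2 : ℝ≥0∞),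
      potential p y ≤ potential q y + d ∧ potential q y ≤ potential p y + d := by
  refine isClosed_Iic.isCompact.eventually_forall_of_forall_eventually
    (K := Set.Iic (1 / 2)) fun y hy => ?_
  have hy1 : y < 1 := hy.trans_lt (by simp)
  have hjoint := (continuousAt_potential hq hy1).tendsto
  have hfixed : Tendsto (fun z : ℝ≥0∞ × ℝ≥0∞ => potential q z.2) (𝓝 (q, y))
      (𝓝 (potential q y)) :=
    hjoint.comp ((continuous_const.prodMk continuous_snd).tendsto (q, y))
  have hlt : potential q y < potential q y + d :=
    ENNReal.lt_add_right (((potential_le_iff hq ENNReal.one_ne_top).2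
      (by simpa using hy1.le)).trans_lt ENNReal.one_lt_top).ne hd
  filter_upwards [hjoint.eventually_lt (hfixed.add_const d) hlt,
    hfixed.eventually_lt (hjoint.add_const d) hlt] with z h₁ h₂
  exact ⟨h₁.le, h₂.le⟩

end Potential

theorem map_sum_of_pairwise_eq_zero_or {ι A B : Type*} [AddCommMonoid A] [AddCommMonoid B]
    {φ : A → B} (hφ : φ 0 = 0) {a : ι → A} {s : Finset ι}
    (ha : (s : Set ι).Pairwise fun i j => a i = 0 ∨ a j = 0) :
    φ (∑ i ∈ s, a i) = ∑ i ∈ s, φ (a i) := by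
  by_cases h : ∃ i ∈ s, a i ≠ 0
  · obtain ⟨i, hi, hai⟩ := h
    have hzero : ∀ j ∈ s, j ≠ i → a j = 0 := fun j hj hji => (ha hj hi hji).resolve_right hai
    rw [Finset.sum_eq_single_of_mem i hi hzero, Finset.sum_eq_single_of_mem i hi]
    exact fun j hj hji => by rw [hzero j hj hji, hφ]
  · push Not at h
    rw [Finset.sum_eq_zero h, hφ, Finset.sum_eq_zero fun i hi => by rw [h i hi, hφ]]

variable {𝕜 : Type*} [RCLike 𝕜] {Ω : Type*} [MeasurableSpace Ω] {μ ν : Measure Ω}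
  {P : VariableExponent Ω}

section ScaledModular

/-- The modular `ρ_P(|f| / t)` of `f ∈ L_P(μ)` at the scale `t > 0`, computed with respect to a
second measure `ν` (a restriction of `μ` to a region where the exponent is controlled). -/
noncomputable def scaledModular (ν : Measure Ω) (f : VarLp 𝕜 P μ) (t : ℝ) : ℝ≥0∞ :=
  modular P ν fun ω => ‖(f : Ω →ₘ[μ] 𝕜) ω‖ₑ / ENNReal.ofReal t

theorem scaledModular_mono_measure (h : ν ≤ μ) (f : VarLp 𝕜 P μ) (t : ℝ) :
    scaledModular ν f t ≤ scaledModular μ f t :=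
  lintegral_mono' h le_rfl

theorem scaledModular_lt_one_of_norm_lt (hP : 0 < lowerExponent P μ) {f : VarLp 𝕜 P μ}
    {t : ℝ} (h : ‖f‖ < t) : scaledModular μ f t < 1 := by
  obtain ⟨s, ⟨-, -, hs⟩, hst⟩ := sInf_lt_iff.1
    ((ENNReal.lt_ofReal_iff_toReal_lt (luxemburg_lt_top hP f).ne).2 h)
  refine (modular_mono P μ (.of_forall fun ω => ?_)).trans_lt hs
  gcongr

theorem norm_le_of_scaledModular_lt_one {f : VarLp 𝕜 P μ} {t : ℝ} (ht : 0 < t)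
    (h : scaledModular μ f t < 1) : ‖f‖ ≤ t :=
  ENNReal.toReal_le_of_le_ofReal ht.le (sInf_le ⟨ENNReal.ofReal_pos.2 ht, ENNReal.ofReal_lt_top, h⟩)

theorem enorm_div_ofReal_mul_rpow (z : 𝕜) (t : ℝ) {M r : ℝ} (hM : 0 < M) :
    ‖z‖ₑ / ENNReal.ofReal (t * M ^ r) = ‖z‖ₑ / ENNReal.ofReal t / ENNReal.ofReal M ^ r := by
  rw [ENNReal.ofReal_mul' (by positivity), ENNReal.ofReal_rpow_of_pos hM, div_eq_mul_inv,
    ENNReal.mul_inv (.inr ENNReal.ofReal_ne_top) (.inl ENNReal.ofReal_ne_top), ← mul_assoc,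
    div_eq_mul_inv, div_eq_mul_inv]

theorem scaledModular_mul_rpow_inv_le {p : ℝ≥0∞} (hp : 0 < p)
    (hPν : ∀ᵐ ω ∂ν, p ≤ P.toFun ω) {M : ℝ} (hM : 1 ≤ M) (f : VarLp 𝕜 P μ) (t : ℝ) :
    scaledModular ν f (t * M ^ p.toReal⁻¹) ≤ scaledModular ν f t / ENNReal.ofReal M := by
  have hM0 : 0 < M := one_pos.trans_le hM
  rw [scaledModular, scaledModular, modular, modular, div_eq_mul_inv,
    ← lintegral_mul_const' _ _ (ENNReal.inv_ne_top.2 (ENNReal.ofReal_pos.2 hM0).ne')]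
  refine lintegral_mono_ae (hPν.mono fun ω hω => ?_)
  rw [enorm_div_ofReal_mul_rpow _ _ hM0, ← div_eq_mul_inv]
  exact potential_div_rpow_inv_le hp hω (ENNReal.one_le_ofReal.2 hM) ENNReal.ofReal_ne_top

theorem le_scaledModular_mul_rpow_inv {p : ℝ≥0∞} (hPν : ∀ᵐ ω ∂ν, P.toFun ω ≤ p) {M : ℝ}
    (hM : 1 ≤ M) (f : VarLp 𝕜 P μ) (t : ℝ) :
    scaledModular ν f t / ENNReal.ofReal M ≤ scaledModular ν f (t * M ^ p.toReal⁻¹) := by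
  have hM0 : 0 < M := one_pos.trans_le hM
  rw [scaledModular, scaledModular, modular, modular, div_eq_mul_inv,
    ← lintegral_mul_const' _ _ (ENNReal.inv_ne_top.2 (ENNReal.ofReal_pos.2 hM0).ne')]
  refine lintegral_mono_ae (hPν.mono fun ω hω => ?_)
  rw [enorm_div_ofReal_mul_rpow _ _ hM0, ← div_eq_mul_inv]
  exact le_potential_div_rpow_inv (P.pos ω) hω (ENNReal.one_le_ofReal.2 hM) ENNReal.ofReal_ne_top

theorem VarLp.coeFn_finset_sum {ι : Type*} (s : Finset ι) (x : ι → VarLp 𝕜 P μ) :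
    ⇑((∑ i ∈ s, x i : VarLp 𝕜 P μ) : Ω →ₘ[μ] 𝕜) =ᵐ[μ]
      fun ω => ∑ i ∈ s, (x i : Ω →ₘ[μ] 𝕜) ω := by
  induction s using Finset.cons_induction with
  | empty => exact AEEqFun.coeFn_zero
  | cons i s hi ih =>
    rw [Finset.sum_cons, Submodule.coe_add]
    filter_upwards [ih, AEEqFun.coeFn_add (x i : Ω →ₘ[μ] 𝕜) (∑ i ∈ s, x i : VarLp 𝕜 P μ)]
      with ω hsum hadd
    rw [hadd, Pi.add_apply, hsum, Finset.sum_cons]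

theorem DisjointlySupported.ae_pairwise_eq_zero_or {x : ℕ → VarLp 𝕜 P μ}
    (hx : DisjointlySupported x) :
    ∀ᵐ ω ∂μ, Pairwise fun n m => (x n : Ω →ₘ[μ] 𝕜) ω = 0 ∨ (x m : Ω →ₘ[μ] 𝕜) ω = 0 := by
  simp only [Pairwise, ae_all_iff]
  intro n m hnm
  filter_upwards [measure_eq_zero_iff_ae_notMem.1 (hx hnm)] with ω hω
  simpa only [Set.mem_inter_iff, mem_support, not_and_or, not_not] using hω

theorem DisjointlySupported.smul {x : ℕ → VarLp 𝕜 P μ} (hx : DisjointlySupported x) (b : ℕ → 𝕜) :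
    DisjointlySupported fun n => b n • x n := by
  intro n m hnm
  refine measure_eq_zero_iff_ae_notMem.2 ?_
  filter_upwards [hx.ae_pairwise_eq_zero_or, AEEqFun.coeFn_smul (b n) (x n : Ω →ₘ[μ] 𝕜),
    AEEqFun.coeFn_smul (b m) (x m : Ω →ₘ[μ] 𝕜)] with ω hω hn hm
  have hzero := hω hnm
  simp only [Submodule.coe_smul, Set.mem_inter_iff, mem_support, hn, hm, Pi.smul_apply, smul_eq_mul,
    mul_ne_zero_iff]
  tauto

theorem DisjointlySupported.scaledModular_sum {x : ℕ → VarLp 𝕜 P μ} (hx : DisjointlySupported x)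
    (hν : ν ≪ μ) (s : Finset ℕ) (t : ℝ) :
    scaledModular ν (∑ n ∈ s, x n) t = ∑ n ∈ s, scaledModular ν (x n) t := by
  have hmeas : ∀ n ∈ s, AEMeasurable
      (fun ω => potential (P.toFun ω) (‖(x n : Ω →ₘ[μ] 𝕜) ω‖ₑ / ENNReal.ofReal t)) ν := fun n _ =>
    potential_measurable.comp_aemeasurable (P.measurable.aemeasurable.prodMk
      (((x n : Ω →ₘ[μ] 𝕜).aestronglyMeasurable.mono_ac hν).enorm.div_const _))
  simp only [scaledModular, modular]
  rw [← lintegral_finsetSum' s hmeas]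
  refine lintegral_congr_ae ?_
  filter_upwards [hν.ae_le (VarLp.coeFn_finset_sum s x), hν.ae_le hx.ae_pairwise_eq_zero_or]
    with ω hsum hzero
  rw [hsum]
  exact map_sum_of_pairwise_eq_zero_or
    (φ := fun z : 𝕜 => potential (P.toFun ω) (‖z‖ₑ / ENNReal.ofReal t))
    (by simp [potential_zero (P.pos ω)]) (hzero.set_pairwise _)

end ScaledModular

section UnitVectors

theorem sum_indicator_smul {Z : Type*} [AddCommGroup Z] [Module 𝕜 Z] (s : Finset ℕ) (z : ℕ → Z) :
    ((Finsupp.indicator s fun _ _ => (1 : 𝕜)).sum fun n t => t • z n) = ∑ n ∈ s, z n := by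
  rw [Finsupp.sum_of_support_subset _ (Finsupp.support_indicator_subset _ _) _ (by simp)]
  exact Finset.sum_congr rfl fun n hn => by rw [Finsupp.indicator_of_mem hn, one_smul]

theorem EquivalentSequences.exists_norm_sum_bounds {X Y : Type*} [AddCommGroup X] [Module 𝕜 X]
    [Norm X] [AddCommGroup Y] [Module 𝕜 Y] [Norm Y] {x : ℕ → X} {y : ℕ → Y}
    (h : EquivalentSequences 𝕜 x y) :
    ∃ c C : ℝ, 0 < c ∧ ∀ s : Finset ℕ, c * ‖∑ n ∈ s, y n‖ ≤ ‖∑ n ∈ s, x n‖ ∧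
      ‖∑ n ∈ s, x n‖ ≤ C * ‖∑ n ∈ s, y n‖ := by
  obtain ⟨c, C, hc, -, h⟩ := h
  refine ⟨c, C, hc, fun s => ?_⟩
  simpa only [sum_indicator_smul] using h (Finsupp.indicator s fun _ _ => (1 : 𝕜))

theorem smul_unitVector (q : ℝ≥0∞) (b : 𝕜) (n : ℕ) : b • unitVector 𝕜 q n = lp.single q n b := by
  rw [unitVector, ← lp.single_smul, smul_eq_mul, mul_one]

theorem sum_smul_unitVector_apply (q : ℝ≥0∞) (s : Finset ℕ) (b : ℕ → 𝕜) (n : ℕ) :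
    (∑ n ∈ s, b n • unitVector 𝕜 q n : lp (fun _ : ℕ => 𝕜) q) n = if n ∈ s then b n else 0 := by
  simp only [smul_unitVector]
  rw [lp.coeFn_sum, Finset.sum_apply]
  simp [lp.single_apply, Pi.single_apply]

theorem norm_sum_smul_unitVector_rpow {q : ℝ≥0∞} (hq : 0 < q) (hq' : q ≠ ∞) (s : Finset ℕ)
    (b : ℕ → 𝕜) :
    ‖∑ n ∈ s, b n • unitVector 𝕜 q n‖ ^ q.toReal = ∑ n ∈ s, ‖b n‖ ^ q.toReal := by
  simp only [smul_unitVector]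
  exact lp.norm_sum_single (ENNReal.toReal_pos hq.ne' hq') b s

theorem norm_sum_smul_unitVector_top_le_iff (s : Finset ℕ) (b : ℕ → 𝕜) {t : ℝ} (ht : 0 ≤ t) :
    ‖∑ n ∈ s, b n • unitVector 𝕜 ∞ n‖ ≤ t ↔ ∀ n ∈ s, ‖b n‖ ≤ t := by
  refine ⟨fun h n hn => ?_, fun h => lp.norm_le_of_forall_le ht fun n => ?_⟩
  · have hcoord := lp.norm_apply_le_norm ENNReal.top_ne_zero (∑ n ∈ s, b n • unitVector 𝕜 ∞ n) n
    rw [sum_smul_unitVector_apply, if_pos hn] at hcoord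
    exact hcoord.trans h
  · rw [sum_smul_unitVector_apply]
    split_ifs with hn
    exacts [h n hn, by simpa using ht]

theorem potential_top_div_ofReal {a t : ℝ} (ht : 0 < t) :
    potential ∞ (ENNReal.ofReal a / ENNReal.ofReal t) = if a ≤ t then 0 else ∞ := by
  rw [potential_top, ← ENNReal.ofReal_div_of_pos ht]
  simp only [ENNReal.ofReal_le_one, div_le_one ht]

theorem sum_potential_enorm_div {q : ℝ≥0∞} (hq : 0 < q) (s : Finset ℕ) (b : ℕ → 𝕜) {t : ℝ}
    (ht : 0 < t) :
    ∑ n ∈ s, potential q (‖b n‖ₑ / ENNReal.ofReal t) =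
      potential q (ENNReal.ofReal ‖∑ n ∈ s, b n • unitVector 𝕜 q n‖ / ENNReal.ofReal t) := by
  simp only [← ofReal_norm]
  rcases eq_or_ne q ∞ with rfl | hq'
  · simp only [potential_top_div_ofReal ht, norm_sum_smul_unitVector_top_le_iff s b ht.le]
    split_ifs with h
    · exact Finset.sum_eq_zero fun n hn => if_pos (h n hn)
    · push Not at h
      obtain ⟨n, hn, hnt⟩ := h
      exact ENNReal.sum_eq_top.2 ⟨n, hn, if_neg hnt.not_ge⟩
  · have hq0 : 0 ≤ q.toReal := ENNReal.toReal_nonneg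
    simp only [potential_of_ne_top hq', ENNReal.div_rpow_of_nonneg _ _ hq0,
      ENNReal.ofReal_rpow_of_nonneg (norm_nonneg _) hq0,
      ENNReal.ofReal_rpow_of_nonneg (lp.norm_nonneg' _) hq0,
      norm_sum_smul_unitVector_rpow hq hq']
    rw [ENNReal.ofReal_sum_of_nonneg fun n _ => by positivity]
    simp only [div_eq_mul_inv, Finset.sum_mul]

theorem sum_potential_enorm_div_mul_rpow_inv {q : ℝ≥0∞} (hq : 0 < q) (s : Finset ℕ) (b : ℕ → 𝕜)
    (t : ℝ) {M : ℝ} (hM : 0 < M) :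
    ∑ n ∈ s, potential q (‖b n‖ₑ / ENNReal.ofReal (t * M ^ q.toReal⁻¹)) =
      (∑ n ∈ s, potential q (‖b n‖ₑ / ENNReal.ofReal t)) / ENNReal.ofReal M := by
  simp only [enorm_div_ofReal_mul_rpow _ _ hM, potential_div_rpow_inv hq ENNReal.ofReal_ne_top]
  simp only [div_eq_mul_inv, Finset.sum_mul]

theorem potential_div_ofReal_le_one_iff {q : ℝ≥0∞} (hq : 0 < q) {a t : ℝ} (ht : 0 < t) :
    potential q (ENNReal.ofReal a / ENNReal.ofReal t) ≤ 1 ↔ a ≤ t := by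
  rw [potential_le_iff hq ENNReal.one_ne_top, ENNReal.one_rpow, ← ENNReal.ofReal_div_of_pos ht,
    ENNReal.ofReal_le_one, div_le_one ht]

theorem norm_sum_unitVector {q : ℝ≥0∞} (hq : 0 < q) {s : Finset ℕ} (hs : s.Nonempty) :
    ‖∑ n ∈ s, unitVector 𝕜 q n‖ = (s.card : ℝ) ^ q.toReal⁻¹ := by
  have hcard : (0 : ℝ) < s.card := by exact_mod_cast hs.card_pos
  have hcard' : (0 : ℝ) < (s.card : ℝ) ^ q.toReal⁻¹ := Real.rpow_pos_of_pos hcard _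
  have hle_iff : ∀ u : ℝ, 0 < u →
      (‖∑ n ∈ s, unitVector 𝕜 q n‖ ≤ u * (s.card : ℝ) ^ q.toReal⁻¹ ↔ 1 ≤ u) := by
    intro u hu
    have hsum := sum_potential_enorm_div hq s (fun _ => (1 : 𝕜)) (mul_pos hu hcard')
    rw [sum_potential_enorm_div_mul_rpow_inv hq s _ u hcard, ENNReal.ofReal_natCast,
      Finset.sum_const, nsmul_eq_mul, mul_div_assoc, ENNReal.mul_div_cancel
        (by exact_mod_cast hcard.ne') (ENNReal.natCast_ne_top s.card)] at hsum
    simp only [one_smul] at hsum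
    rw [← potential_div_ofReal_le_one_iff hq (mul_pos hu hcard'), ← hsum, ← ofReal_norm, norm_one,
      potential_div_ofReal_le_one_iff hq hu]
  refine le_antisymm (by simpa using (hle_iff 1 one_pos).2 le_rfl)
    (le_of_forall_gt_imp_ge_of_dense fun t ht => ?_)
  have ht0 : 0 < t := (lp.norm_nonneg' _).trans_lt ht
  exact (one_le_div hcard').1 ((hle_iff _ (div_pos ht0 hcard')).1
    (by rw [div_mul_cancel₀ _ hcard'.ne']; exact ht.le))

end UnitVectors

section EssentialRange

variable {q : ℝ≥0∞}

theorem exists_nhds_ae_notMem_of_notMem_essentialRange (h : q ∉ essentialRange P μ) :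
    ∃ U ∈ 𝓝 q, ∀ᵐ ω ∂μ, P.toFun ω ∉ U := by
  obtain ⟨U, hU, hU0⟩ := Measure.notMem_support_iff_exists.1 h
  exact ⟨U, hU, ae_of_ae_map P.measurable.aemeasurable (measure_eq_zero_iff_ae_notMem.1 hU0)⟩

theorem exists_lt_ae_le_of_notMem_essentialRange (hq : 0 < q) (h : q ∉ essentialRange P μ) :
    ∃ p, 0 < p ∧ p < q ∧ ∀ᵐ ω ∂μ, P.toFun ω ≤ q → P.toFun ω ≤ p := by
  obtain ⟨U, hU, hPU⟩ := exists_nhds_ae_notMem_of_notMem_essentialRange h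
  obtain ⟨p, hp, hpU⟩ := exists_Ioc_subset_of_mem_nhds hU ⟨0, hq⟩
  obtain ⟨p', hpp', hp'q⟩ := exists_between hp
  refine ⟨p', zero_le.trans_lt hpp', hp'q, hPU.mono fun ω hω hωq => ?_⟩
  by_contra! hlt
  exact hω (hpU ⟨hpp'.trans hlt, hωq⟩)

theorem exists_gt_ae_le_of_notMem_essentialRange (hq : q ≠ ∞) (h : q ∉ essentialRange P μ) :
    ∃ p, q < p ∧ ∀ᵐ ω ∂μ, q < P.toFun ω → p ≤ P.toFun ω := by
  obtain ⟨U, hU, hPU⟩ := exists_nhds_ae_notMem_of_notMem_essentialRange h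
  obtain ⟨p, hp, hpU⟩ := exists_Ico_subset_of_mem_nhds hU ⟨∞, hq.lt_top⟩
  refine ⟨p, hp, hPU.mono fun ω hω hqω => ?_⟩
  by_contra! hlt
  exact hω (hpU ⟨hqω.le, hlt⟩)

end EssentialRange

section Necessity

theorem eventually_mul_rpow_lt_mul_rpow {s a : ℝ} (hsa : s < a) (C : ℝ) {δ : ℝ} (hδ : 0 < δ) :
    ∀ᶠ N : ℕ in atTop, C * (N : ℝ) ^ s < δ * (N : ℝ) ^ a := by
  have hgrowth : Tendsto (fun N : ℕ => (N : ℝ) ^ (a - s)) atTop atTop :=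
    (tendsto_rpow_atTop (sub_pos.2 hsa)).comp tendsto_natCast_atTop_atTop
  filter_upwards [hgrowth.eventually_gt_atTop (C / δ), eventually_gt_atTop 0] with N hN hN0
  have hN0' : (0 : ℝ) < N := by exact_mod_cast hN0
  rw [Real.rpow_sub hN0', div_lt_div_iff₀ hδ (Real.rpow_pos_of_pos hN0' s)] at hN
  linarith

theorem finite_setOf_le_scaledModular (hP : 0 < lowerExponent P μ) {x : ℕ → VarLp 𝕜 P μ}
    (hx : DisjointlySupported x) {p : ℝ≥0∞} {C s : ℝ} (hs : s < p.toReal⁻¹)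
    (hC : ∀ S : Finset ℕ, S.Nonempty → ‖∑ n ∈ S, x n‖ ≤ C * (S.card : ℝ) ^ s)
    (hν : ν ≤ μ) (hPν : ∀ᵐ ω ∂ν, P.toFun ω ≤ p) {ε δ : ℝ} (hε : 0 < ε) (hδ : 0 < δ) :
    {n | ENNReal.ofReal ε ≤ scaledModular ν (x n) δ}.Finite := by
  by_contra hinf
  obtain ⟨N, ⟨hN, hNε⟩, hN0⟩ := (((eventually_mul_rpow_lt_mul_rpow hs C
    (mul_pos hδ (Real.rpow_pos_of_pos hε p.toReal⁻¹))).and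
    ((tendsto_natCast_atTop_atTop (R := ℝ)).eventually_ge_atTop ε⁻¹)).and
    (eventually_gt_atTop 0)).exists
  obtain ⟨S, hS, rfl⟩ := Set.Infinite.exists_subset_card_eq hinf N
  have hM : 1 ≤ ε * (S.card : ℝ) := (inv_le_iff_one_le_mul₀' hε).1 hNε
  have hlt : ‖∑ n ∈ S, x n‖ < δ * (ε * (S.card : ℝ)) ^ p.toReal⁻¹ := by
    rw [Real.mul_rpow hε.le (Nat.cast_nonneg _), ← mul_assoc]
    exact (hC S (Finset.card_pos.1 hN0)).trans_lt hN
  refine (scaledModular_lt_one_of_norm_lt hP hlt).not_ge ?_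
  refine le_trans ?_ (scaledModular_mono_measure hν _ _)
  rw [hx.scaledModular_sum (Measure.absolutelyContinuous_of_le hν)]
  have hterm : ∀ n ∈ S, ENNReal.ofReal ε / ENNReal.ofReal (ε * S.card) ≤
      scaledModular ν (x n) (δ * (ε * (S.card : ℝ)) ^ p.toReal⁻¹) := fun n hn =>
    (ENNReal.div_le_div_right (hS hn) _).trans (le_scaledModular_mul_rpow_inv hPν hM _ _)
  calc (1 : ℝ≥0∞) = S.card • (ENNReal.ofReal ε / ENNReal.ofReal (ε * S.card)) := by
        rw [← ENNReal.ofReal_div_of_pos (by linarith), nsmul_eq_mul, ← ENNReal.ofReal_natCast,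
          ← ENNReal.ofReal_mul (Nat.cast_nonneg _), ← mul_div_assoc, mul_comm,
          div_self (by linarith), ENNReal.ofReal_one]
    _ ≤ _ := Finset.card_nsmul_le_sum _ _ _ hterm

theorem exists_norm_sum_le_of_finite_setOf_le_scaledModular {x : ℕ → VarLp 𝕜 P μ}
    (hx : DisjointlySupported x) {A : Set Ω} (hA : MeasurableSet A) {p : ℝ≥0∞} (hp : 0 < p)
    (hPA : ∀ᵐ ω ∂(μ.restrict Aᶜ), p ≤ P.toFun ω) {K : ℝ} (hK : 0 < K)
    (hxK : ∀ n, scaledModular μ (x n) K ≤ 1)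
    (hfin : ∀ ε δ : ℝ, 0 < ε → 0 < δ →
      {n | ENNReal.ofReal ε ≤ scaledModular (μ.restrict A) (x n) δ}.Finite)
    {N : ℕ} (hN : 0 < N) :
    ∃ S : Finset ℕ, S.card = N ∧ ‖∑ n ∈ S, x n‖ ≤ K * (3 * N : ℝ) ^ p.toReal⁻¹ := by
  have hN1 : (1 : ℝ) ≤ N := by exact_mod_cast hN
  set T : ℝ := K * (3 * N : ℝ) ^ p.toReal⁻¹
  have hT : 0 < T := by positivity
  obtain ⟨S, hS, hcard⟩ :=
    (hfin (3 * N : ℝ)⁻¹ T (by positivity) hT).infinite_compl.exists_subset_card_eq N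
  refine ⟨S, hcard, norm_le_of_scaledModular_lt_one hT ?_⟩
  rw [hx.scaledModular_sum Measure.AbsolutelyContinuous.rfl]
  have hterm : ∀ n ∈ S, scaledModular μ (x n) T ≤ ENNReal.ofReal (2 * (3 * N : ℝ)⁻¹) := fun n hn =>
    calc scaledModular μ (x n) T
        = scaledModular (μ.restrict A) (x n) T + scaledModular (μ.restrict Aᶜ) (x n) T :=
          (lintegral_add_compl _ hA).symm
      _ ≤ ENNReal.ofReal (3 * N : ℝ)⁻¹ + ENNReal.ofReal (3 * N : ℝ)⁻¹ := by
          refine add_le_add (lt_of_not_ge fun hge => hS hn hge).le ?_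
          refine (scaledModular_mul_rpow_inv_le hp hPA (by linarith) _ _).trans ?_
          rw [ENNReal.ofReal_inv_of_pos (by positivity), ← one_div]
          exact ENNReal.div_le_div_right
            ((scaledModular_mono_measure Measure.restrict_le_self _ _).trans (hxK n)) _
      _ = ENNReal.ofReal (2 * (3 * N : ℝ)⁻¹) := by
          rw [← ENNReal.ofReal_add (by positivity) (by positivity), two_mul]
  calc ∑ n ∈ S, scaledModular μ (x n) T
      ≤ S.card • ENNReal.ofReal (2 * (3 * N : ℝ)⁻¹) := Finset.sum_le_card_nsmul _ _ _ hterm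
    _ = ENNReal.ofReal (2 / 3) := by
        rw [hcard, nsmul_eq_mul, ← ENNReal.ofReal_natCast, ← ENNReal.ofReal_mul (by positivity)]
        congr 1
        field_simp
    _ < 1 := by rw [ENNReal.ofReal_lt_one]; norm_num

theorem mem_essentialRange_of_norm_sum_bounds (hP : 0 < lowerExponent P μ) {q : ℝ≥0∞} (hq : 0 < q)
    {x : ℕ → VarLp 𝕜 P μ} (hx : DisjointlySupported x) {c C : ℝ} (hc : 0 < c)
    (hbounds : ∀ S : Finset ℕ, S.Nonempty → c * (S.card : ℝ) ^ q.toReal⁻¹ ≤ ‖∑ n ∈ S, x n‖ ∧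
      ‖∑ n ∈ S, x n‖ ≤ C * (S.card : ℝ) ^ q.toReal⁻¹) :
    q ∈ essentialRange P μ := by
  by_contra hqR
  obtain ⟨p, hp, hpq, hPp⟩ := exists_lt_ae_le_of_notMem_essentialRange hq hqR
  have hA : MeasurableSet {ω | P.toFun ω ≤ q} := P.measurable measurableSet_Iic
  have hx_bounds : ∀ n, c ≤ ‖x n‖ ∧ ‖x n‖ ≤ C := fun n => by
    simpa using hbounds {n} (Finset.singleton_nonempty n)
  have hC : 0 < C := hc.trans_le ((hx_bounds 0).1.trans (hx_bounds 0).2)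
  have hfin : ∀ ε δ : ℝ, 0 < ε → 0 < δ → {n | ENNReal.ofReal ε ≤
      scaledModular (μ.restrict {ω | P.toFun ω ≤ q}) (x n) δ}.Finite := fun ε δ hε hδ =>
    finite_setOf_le_scaledModular hP hx (toReal_inv_strictAnti hp hpq)
      (fun S hS => (hbounds S hS).2) Measure.restrict_le_self ((ae_restrict_iff' hA).2 hPp) hε hδ
  rcases eq_or_ne q ∞ with rfl | hq'
  · refine Set.infinite_univ ((hfin 1 (c / 2) one_pos (half_pos hc)).subset fun n _ => ?_)
    have hA_univ : {ω | P.toFun ω ≤ ∞} = Set.univ := by ext; simp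
    rw [Set.mem_ofPred_eq, ENNReal.ofReal_one, hA_univ, Measure.restrict_univ]
    by_contra! hlt
    linarith [norm_le_of_scaledModular_lt_one (half_pos hc) hlt, (hx_bounds n).1]
  · obtain ⟨p', hqp', hPp'⟩ := exists_gt_ae_le_of_notMem_essentialRange hq' hqR
    have hPA : ∀ᵐ ω ∂(μ.restrict {ω | P.toFun ω ≤ q}ᶜ), p' ≤ P.toFun ω :=
      (ae_restrict_iff' hA.compl).2 (hPp'.mono fun ω hω hωA => hω (not_le.1 hωA))
    obtain ⟨N, hN, hN0⟩ := ((eventually_mul_rpow_lt_mul_rpow (toReal_inv_strictAnti hq hqp')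
      (2 * C * 3 ^ p'.toReal⁻¹) hc).and (eventually_gt_atTop 0)).exists
    obtain ⟨S, rfl, hS⟩ := exists_norm_sum_le_of_finite_setOf_le_scaledModular hx hA
      (hq.trans hqp') hPA (by positivity : 0 < 2 * C) (fun n =>
        (scaledModular_lt_one_of_norm_lt hP (by linarith [(hx_bounds n).2])).le) hfin hN0
    rw [Real.mul_rpow (by norm_num) (Nat.cast_nonneg _), ← mul_assoc] at hS
    exact (((hbounds S (Finset.card_pos.1 hN0)).1.trans hS).trans_lt hN).false

theorem mem_essentialRange_of_equivalentSequences (hP : 0 < lowerExponent P μ) {q : ℝ≥0∞}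
    (hq : 0 < q) {x : ℕ → VarLp 𝕜 P μ} (hx : DisjointlySupported x)
    (h : EquivalentSequences 𝕜 x (unitVector 𝕜 q)) : q ∈ essentialRange P μ := by
  obtain ⟨c, C, hc, hbounds⟩ := h.exists_norm_sum_bounds
  refine mem_essentialRange_of_norm_sum_bounds hP hq hx hc (C := C) fun S hS => ?_
  simpa only [norm_sum_unitVector hq hS] using hbounds S

end Necessity

section Nonatomic

/-- A measure is semifinite if every measurable set of positive measure has a measurable subset of
positive finite measure. This weakening of σ-finiteness lets one build normalized indicators. -/
def IsSemifinite (μ : Measure Ω) : Prop :=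
  ∀ A, MeasurableSet A → 0 < μ A → ∃ B ⊆ A, MeasurableSet B ∧ 0 < μ B ∧ μ B < ∞

theorem isSemifinite_of_sigmaFinite (μ : Measure Ω) [SigmaFinite μ] : IsSemifinite μ := by
  intro A hA hA0
  obtain ⟨B, hB, hBA, hB0, hBfin⟩ := Measure.exists_subset_measure_lt_top hA hA0
  exact ⟨B, hBA, hB, hB0, hBfin⟩

theorem IsNonatomic.exists_subset_measure_le_half (hμ : IsNonatomic μ) {A : Set Ω}
    (hA : MeasurableSet A) (hA0 : 0 < μ A) (hfin : μ A < ∞) :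
    ∃ B ⊆ A, MeasurableSet B ∧ 0 < μ B ∧ μ B ≤ μ A / 2 := by
  have hsplit := hμ A
  simp only [IsMeasureAtom, hA, hA0, true_and] at hsplit
  push Not at hsplit
  obtain ⟨B, hBA, hB, hB0, hAB0⟩ := hsplit
  rcases le_or_gt (μ B) (μ A / 2) with hle | hgt
  · exact ⟨B, hBA, hB, pos_iff_ne_zero.2 hB0, hle⟩
  · refine ⟨A \ B, Set.sdiff_subset, hA.diff hB, pos_iff_ne_zero.2 hAB0, ?_⟩
    rw [measure_sdiff hBA hB.nullMeasurableSet (measure_lt_top_of_subset hBA hfin.ne).ne,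
      tsub_le_iff_right]
    exact (ENNReal.add_halves (μ A)).ge.trans (by gcongr)

theorem IsNonatomic.exists_subset_measure_lt (hμ : IsNonatomic μ) (hμ' : IsSemifinite μ)
    {A : Set Ω} (hA : MeasurableSet A) (hA0 : 0 < μ A) {ε : ℝ≥0∞} (hε : 0 < ε) :
    ∃ B ⊆ A, MeasurableSet B ∧ 0 < μ B ∧ μ B < ε := by
  obtain ⟨B, hBA, hB, hB0, hBfin⟩ := hμ' A hA hA0
  have hhalving : ∀ n : ℕ, ∃ D ⊆ B, MeasurableSet D ∧ 0 < μ D ∧ μ D ≤ 2⁻¹ ^ n * μ B := by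
    intro n
    induction n with
    | zero => exact ⟨B, subset_rfl, hB, hB0, by simp⟩
    | succ n ih =>
      obtain ⟨D, hDB, hD, hD0, hDn⟩ := ih
      obtain ⟨D', hD'D, hD', hD'0, hle⟩ :=
        hμ.exists_subset_measure_le_half hD hD0 (measure_lt_top_of_subset hDB hBfin.ne)
      refine ⟨D', hD'D.trans hDB, hD', hD'0, hle.trans ?_⟩
      rw [pow_succ', mul_assoc, ENNReal.div_eq_inv_mul]
      gcongr
  obtain ⟨n, hn⟩ := ENNReal.exists_inv_two_pow_lt (ENNReal.div_pos hε.ne' hBfin.ne).ne'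
  obtain ⟨D, hDB, hD, hD0, hDn⟩ := hhalving n
  exact ⟨D, hDB.trans hBA, hD, hD0,
    hDn.trans_lt ((ENNReal.lt_div_iff_mul_lt (.inl hB0.ne') (.inl hBfin.ne)).1 hn)⟩

theorem IsNonatomic.exists_seq_subset (hμ : IsNonatomic μ) (hμ' : IsSemifinite μ)
    {G : ℕ → Set Ω} (hG : ∀ n, MeasurableSet (G n)) (hG0 : ∀ n, 0 < μ (G n)) :
    ∃ F : ℕ → Set Ω, (∀ n, F n ⊆ G n ∧ MeasurableSet (F n) ∧ 0 < μ (F n) ∧ μ (F n) < ∞) ∧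
      ∀ n, μ (F (n + 1)) ≤ 3⁻¹ * μ (F n) := by
  have hstep : ∀ n (t : ℝ≥0∞), 0 < t → ∃ B ⊆ G n, MeasurableSet B ∧ 0 < μ B ∧ μ B < t :=
    fun n _ ht => hμ.exists_subset_measure_lt hμ' (hG n) (hG0 n) ht
  choose! B hBG hB hB0 hBt using hstep
  let F : ℕ → Set Ω := fun n => n.rec (B 0 ∞) fun n A => B (n + 1) (3⁻¹ * μ A)
  have hF0 : ∀ n, 0 < μ (F n) := fun n => by
    induction n with
    | zero => exact hB0 0 ∞ ENNReal.zero_lt_top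
    | succ n ih => exact hB0 (n + 1) _ (ENNReal.mul_pos (by simp) ih.ne')
  have hscale : ∀ n, 0 < 3⁻¹ * μ (F n) := fun n => ENNReal.mul_pos (by simp) (hF0 n).ne'
  refine ⟨F, fun n => ?_, fun n => (hBt (n + 1) _ (hscale n)).le⟩
  cases n with
  | zero => exact ⟨hBG 0 ∞ ENNReal.zero_lt_top, hB 0 ∞ ENNReal.zero_lt_top, hF0 0,
      hBt 0 ∞ ENNReal.zero_lt_top⟩
  | succ n => exact ⟨hBG _ _ (hscale n), hB _ _ (hscale n), hF0 (n + 1),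
      lt_top_of_lt (hBt _ _ (hscale n))⟩

theorem tsum_inv_three_pow_succ_lt_one : ∑' k : ℕ, (3⁻¹ : ℝ≥0∞) ^ (k + 1) < 1 := by
  have hlt : (3⁻¹ : ℝ≥0∞) < 2⁻¹ := ENNReal.inv_lt_inv.2 (by norm_num)
  rw [ENNReal.tsum_geometric_add_one, ← div_eq_mul_inv,
    ENNReal.div_lt_iff (.inr (by simp)) (.inr (by simp)), one_mul, lt_tsub_iff_right,
    ← ENNReal.inv_two_add_inv_two]
  exact ENNReal.add_lt_add hlt hlt

theorem IsNonatomic.exists_pairwise_disjoint (hμ : IsNonatomic μ) (hμ' : IsSemifinite μ)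
    {G : ℕ → Set Ω} (hG : ∀ n, MeasurableSet (G n)) (hG0 : ∀ n, 0 < μ (G n)) :
    ∃ E : ℕ → Set Ω, (∀ n, E n ⊆ G n ∧ MeasurableSet (E n) ∧ 0 < μ (E n) ∧ μ (E n) < ∞) ∧
      Pairwise (Disjoint on E) := by
  obtain ⟨F, hF, hdecay⟩ := hμ.exists_seq_subset hμ' hG hG0
  choose hFG hFm hF0 hFfin using hF
  have htail : ∀ n k, μ (F (n + k)) ≤ 3⁻¹ ^ k * μ (F n) := fun n k => by
    induction k with
    | zero => simp
    | succ k ih =>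
      rw [pow_succ', mul_assoc]
      exact (hdecay (n + k)).trans (by gcongr)
  have hunion : ∀ n, μ (⋃ k, F (n + (k + 1))) < μ (F n) := fun n =>
    calc μ (⋃ k, F (n + (k + 1))) ≤ ∑' k, μ (F (n + (k + 1))) := measure_iUnion_le _
      _ ≤ ∑' k : ℕ, 3⁻¹ ^ (k + 1) * μ (F n) := ENNReal.tsum_le_tsum fun k => htail n (k + 1)
      _ = (∑' k : ℕ, 3⁻¹ ^ (k + 1)) * μ (F n) := ENNReal.tsum_mul_right
      _ < 1 * μ (F n) := ENNReal.mul_lt_mul_left (hF0 n).ne' (hFfin n).ne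
          tsum_inv_three_pow_succ_lt_one
      _ = μ (F n) := one_mul _
  refine ⟨fun n => F n \ ⋃ k, F (n + (k + 1)), fun n => ⟨Set.sdiff_subset.trans (hFG n),
    (hFm n).diff (.iUnion fun k => hFm _), (tsub_pos_of_lt (hunion n)).trans_le le_measure_sdiff,
    measure_lt_top_of_subset Set.sdiff_subset (hFfin n).ne⟩, ?_⟩
  refine (pairwise_disjoint_on _).2 fun m n hmn => Set.disjoint_left.2 fun ω hm hn => ?_
  obtain ⟨k, rfl⟩ := Nat.exists_eq_add_of_lt hmn
  exact hm.2 (Set.mem_iUnion.2 ⟨k, hn.1⟩)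

end Nonatomic

section NormalizedIndicator

variable {E : Set Ω}

theorem setLAverage_le (hE : MeasurableSet E) {g : Ω → ℝ≥0∞} {c : ℝ≥0∞} (hg : ∀ ω ∈ E, g ω ≤ c) :
    ⨍⁻ ω in E, g ω ∂μ ≤ c := by
  rw [setLAverage_eq]
  refine ENNReal.div_le_of_le_mul ((setLIntegral_mono' hE hg).trans ?_)
  rw [setLIntegral_const]

theorem le_setLAverage (hE : MeasurableSet E) (hE0 : μ E ≠ 0) (hfin : μ E ≠ ∞) {g : Ω → ℝ≥0∞}
    {c : ℝ≥0∞} (hg : ∀ ω ∈ E, c ≤ g ω) : c ≤ ⨍⁻ ω in E, g ω ∂μ := by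
  rw [setLAverage_eq, ENNReal.le_div_iff_mul_le (.inl hE0) (.inl hfin), ← setLIntegral_const]
  exact setLIntegral_mono' hE hg

/-- The function `μ(E) ^ (-1 / P) · 1_E`, whose modular is `1` if `P` is finite on `E`. Where
`P = ∞`, the junk value `(∞ : ℝ≥0∞).toReal⁻¹ = 0` gives the exponent `-1 / ∞ = 0` as intended. -/
noncomputable def normalizedIndicator (𝕜 : Type*) [RCLike 𝕜] (P : VariableExponent Ω)
    (μ : Measure Ω) (E : Set Ω) : Ω → 𝕜 :=
  E.indicator fun ω => ((μ.real E ^ (-(P.toFun ω).toReal⁻¹) : ℝ) : 𝕜)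

theorem measurable_normalizedIndicator (hE : MeasurableSet E) :
    Measurable (normalizedIndicator 𝕜 P μ E) :=
  (RCLike.measurable_ofReal.comp
    (measurable_const.pow P.measurable.ennreal_toReal.inv.neg)).indicator hE

theorem modular_mul_enorm_normalizedIndicator (hE : MeasurableSet E) (hE0 : μ E ≠ 0)
    (hfin : μ E ≠ ∞) (θ : ℝ≥0∞) :
    modular P μ (fun ω => θ * ‖normalizedIndicator 𝕜 P μ E ω‖ₑ) =
      ⨍⁻ ω in E, potential (P.toFun ω) θ ∂μ := by
  have hreal : 0 < μ.real E := ENNReal.toReal_pos hE0 hfin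
  rw [setLAverage_eq, div_eq_mul_inv, ← lintegral_mul_const' _ _ (ENNReal.inv_ne_top.2 hE0),
    ← lintegral_indicator hE, modular]
  refine lintegral_congr fun ω => ?_
  by_cases hω : ω ∈ E
  · rw [Set.indicator_of_mem hω, normalizedIndicator, Set.indicator_of_mem hω, ← div_eq_mul_inv,
      ← potential_div_rpow_inv (P.pos ω) hfin, ← ofReal_norm, RCLike.norm_ofReal,
      abs_of_nonneg (by positivity), ← ENNReal.ofReal_rpow_of_pos hreal,
      ofReal_measureReal hfin, ENNReal.rpow_neg, ← div_eq_mul_inv]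
  · rw [Set.indicator_of_notMem hω, normalizedIndicator, Set.indicator_of_notMem hω, enorm_zero,
      mul_zero, potential_zero (P.pos ω)]

theorem potential_one_le_one {p : ℝ≥0∞} (hp : 0 < p) : potential p 1 ≤ 1 :=
  (potential_le_iff hp ENNReal.one_ne_top).2 (by simp)

/-- The class of `normalizedIndicator` as an element of `L_P(μ)`. -/
noncomputable def normalizedIndicatorLp (𝕜 : Type*) [RCLike 𝕜] (P : VariableExponent Ω)
    (μ : Measure Ω) (hE : MeasurableSet E) (hE0 : μ E ≠ 0) (hfin : μ E ≠ ∞) : VarLp 𝕜 P μ :=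
  ⟨AEEqFun.mk _ (measurable_normalizedIndicator hE).aestronglyMeasurable, 1, one_pos, by
    refine (modular_mono P μ (g := fun ω => 1 * ‖normalizedIndicator 𝕜 P μ E ω‖ₑ) ?_).trans_lt ?_
    · filter_upwards [AEEqFun.coeFn_mk (normalizedIndicator 𝕜 P μ E)
        (measurable_normalizedIndicator hE).aestronglyMeasurable] with ω hω
      rw [hω, ENNReal.coe_one]
    · rw [modular_mul_enorm_normalizedIndicator hE hE0 hfin]
      exact (setLAverage_le hE fun ω _ => potential_one_le_one (P.pos ω)).trans_lt
        ENNReal.one_lt_top⟩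

theorem coeFn_normalizedIndicatorLp (hE : MeasurableSet E) (hE0 : μ E ≠ 0) (hfin : μ E ≠ ∞) :
    (normalizedIndicatorLp 𝕜 P μ hE hE0 hfin : Ω →ₘ[μ] 𝕜) =ᵐ[μ] normalizedIndicator 𝕜 P μ E :=
  AEEqFun.coeFn_mk _ _

theorem scaledModular_smul_normalizedIndicatorLp (hE : MeasurableSet E) (hE0 : μ E ≠ 0)
    (hfin : μ E ≠ ∞) (b : 𝕜) (t : ℝ) :
    scaledModular μ (b • normalizedIndicatorLp 𝕜 P μ hE hE0 hfin) t =
      ⨍⁻ ω in E, potential (P.toFun ω) (‖b‖ₑ / ENNReal.ofReal t) ∂μ := by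
  rw [← modular_mul_enorm_normalizedIndicator (𝕜 := 𝕜) hE hE0 hfin]
  refine lintegral_congr_ae ?_
  filter_upwards [coeFn_normalizedIndicatorLp (𝕜 := 𝕜) (P := P) hE hE0 hfin,
    AEEqFun.coeFn_smul b (normalizedIndicatorLp 𝕜 P μ hE hE0 hfin : Ω →ₘ[μ] 𝕜)] with ω hω hsmul
  rw [Submodule.coe_smul, hsmul, Pi.smul_apply, hω, enorm_smul, ENNReal.mul_div_right_comm]

theorem disjointlySupported_normalizedIndicatorLp {E : ℕ → Set Ω} (hE : ∀ n, MeasurableSet (E n))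
    (hE0 : ∀ n, μ (E n) ≠ 0) (hfin : ∀ n, μ (E n) ≠ ∞) (hdisj : Pairwise (Disjoint on E)) :
    DisjointlySupported fun n => normalizedIndicatorLp 𝕜 P μ (hE n) (hE0 n) (hfin n) := by
  intro n m hnm
  refine measure_eq_zero_iff_ae_notMem.2 ?_
  filter_upwards [coeFn_normalizedIndicatorLp (𝕜 := 𝕜) (P := P) (hE n) (hE0 n) (hfin n),
    coeFn_normalizedIndicatorLp (𝕜 := 𝕜) (P := P) (hE m) (hE0 m) (hfin m)] with ω hn hm hω
  simp only [Set.mem_inter_iff, mem_support, hn, hm] at hω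
  exact Set.disjoint_left.1 (hdisj hnm) (Set.mem_of_indicator_ne_zero hω.1)
    (Set.mem_of_indicator_ne_zero hω.2)

end NormalizedIndicator

section Sufficiency

variable {q : ℝ≥0∞}

/-- Functions `φ n` that agree with the potential `Φ_q` on `[0, 1/2]` up to errors `ε n` of total
size below `1/2`. With `φ n` as modular of the `n`-th coordinate, they define a sequence space
isomorphic to `ℓ_q`. -/
structure IsPotentialPerturbation (q : ℝ≥0∞) (φ : ℕ → ℝ≥0∞ → ℝ≥0∞) (ε : ℕ → ℝ≥0∞) : Prop where
  mono : ∀ n, Monotone (φ n)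
  one_le : ∀ n y, 1 < y → 1 ≤ φ n y
  le_add : ∀ n, ∀ y ≤ 1 / 2, φ n y ≤ potential q y + ε n
  potential_le_add : ∀ n, ∀ y ≤ 1 / 2, potential q y ≤ φ n y + ε n
  tsum_lt : ∑' n, ε n < 1 / 2

theorem sum_potential_enorm_div_le_one_iff (hq : 0 < q) (s : Finset ℕ) (b : ℕ → 𝕜) {t : ℝ}
    (ht : 0 < t) :
    ∑ n ∈ s, potential q (‖b n‖ₑ / ENNReal.ofReal t) ≤ 1 ↔
      ‖∑ n ∈ s, b n • unitVector 𝕜 q n‖ ≤ t := by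
  rw [sum_potential_enorm_div hq s b ht, potential_div_ofReal_le_one_iff hq ht]

theorem div_ofReal_two_mul (y : ℝ≥0∞) (t : ℝ) :
    y / ENNReal.ofReal (2 * t) = y / ENNReal.ofReal t / 2 := by
  rw [ENNReal.ofReal_mul zero_le_two, ENNReal.ofReal_ofNat, mul_comm, div_eq_mul_inv,
    ENNReal.mul_inv (.inr ENNReal.ofNat_ne_top) (.inr two_ne_zero), ← mul_assoc, div_eq_mul_inv,
    div_eq_mul_inv]

namespace IsPotentialPerturbation

variable {φ : ℕ → ℝ≥0∞ → ℝ≥0∞} {ε : ℕ → ℝ≥0∞}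

theorem sum_error_lt (hφ : IsPotentialPerturbation q φ ε) (s : Finset ℕ) :
    ∑ n ∈ s, ε n < 1 / 2 :=
  (ENNReal.sum_le_tsum s).trans_lt hφ.tsum_lt

theorem sum_lt_one (hφ : IsPotentialPerturbation q φ ε) (hq : 0 < q) {s : Finset ℕ} {b : ℕ → 𝕜}
    {t : ℝ} (ht : 0 < t) (h : ‖∑ n ∈ s, b n • unitVector 𝕜 q n‖ ≤ t) :
    ∑ n ∈ s, φ n (‖b n‖ₑ / ENNReal.ofReal (2 * t * 2 ^ q.toReal⁻¹)) < 1 := by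
  have hsum := (sum_potential_enorm_div_le_one_iff hq s b ht).2 h
  have hcoord : ∀ n ∈ s, ‖b n‖ₑ / ENNReal.ofReal (2 * t * 2 ^ q.toReal⁻¹) ≤ 1 / 2 := fun n hn => by
    have hbn : ‖b n‖ₑ / ENNReal.ofReal t ≤ 1 := by
      have := (Finset.single_le_sum_of_canonicallyOrdered hn).trans hsum
      simpa using (potential_le_iff hq ENNReal.one_ne_top).1 this
    rw [mul_assoc, div_ofReal_two_mul]
    gcongr
    refine (ENNReal.div_le_div_left (ENNReal.ofReal_le_ofReal ?_) _).trans hbn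
    exact le_mul_of_one_le_right ht.le (Real.one_le_rpow one_le_two (by positivity))
  calc ∑ n ∈ s, φ n (‖b n‖ₑ / ENNReal.ofReal (2 * t * 2 ^ q.toReal⁻¹))
      ≤ ∑ n ∈ s, (potential q (‖b n‖ₑ / ENNReal.ofReal (2 * t * 2 ^ q.toReal⁻¹)) + ε n) :=
        Finset.sum_le_sum fun n hn => hφ.le_add n _ (hcoord n hn)
    _ = (∑ n ∈ s, potential q (‖b n‖ₑ / ENNReal.ofReal (2 * t))) / 2 + ∑ n ∈ s, ε n := by
        rw [Finset.sum_add_distrib, sum_potential_enorm_div_mul_rpow_inv hq s b _ two_pos,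
          ENNReal.ofReal_ofNat]
    _ ≤ 1 / 2 + ∑ n ∈ s, ε n := by
        gcongr
        refine (Finset.sum_le_sum fun n _ => potential_mono q ?_).trans hsum
        gcongr
        linarith
    _ < 1 / 2 + 1 / 2 := ENNReal.add_lt_add_left (by simp) (hφ.sum_error_lt s)
    _ = 1 := ENNReal.add_halves 1

theorem norm_le_of_sum_lt_one (hφ : IsPotentialPerturbation q φ ε) (hq : 0 < q) {s : Finset ℕ}
    {b : ℕ → 𝕜} {t : ℝ} (ht : 0 < t) (h : ∑ n ∈ s, φ n (‖b n‖ₑ / ENNReal.ofReal t) < 1) :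
    ‖∑ n ∈ s, b n • unitVector 𝕜 q n‖ ≤ 2 * t * 2 ^ q.toReal⁻¹ := by
  have hcoord : ∀ n ∈ s, ‖b n‖ₑ / ENNReal.ofReal (2 * t) ≤ 1 / 2 := fun n hn => by
    rw [div_ofReal_two_mul]
    gcongr
    by_contra! hlt
    have hone : 1 ≤ ∑ n ∈ s, φ n (‖b n‖ₑ / ENNReal.ofReal t) :=
      (hφ.one_le n _ hlt).trans (Finset.single_le_sum_of_canonicallyOrdered
        (f := fun n => φ n (‖b n‖ₑ / ENNReal.ofReal t)) hn)
    exact hone.not_gt h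
  rw [← sum_potential_enorm_div_le_one_iff hq s b (by positivity),
    sum_potential_enorm_div_mul_rpow_inv hq s b _ two_pos, ENNReal.ofReal_ofNat]
  refine ENNReal.div_le_of_le_mul ?_
  calc ∑ n ∈ s, potential q (‖b n‖ₑ / ENNReal.ofReal (2 * t))
      ≤ ∑ n ∈ s, (φ n (‖b n‖ₑ / ENNReal.ofReal t) + ε n) := Finset.sum_le_sum fun n hn =>
        (hφ.potential_le_add n _ (hcoord n hn)).trans (by
          gcongr
          exact hφ.mono n (ENNReal.div_le_div_left (ENNReal.ofReal_le_ofReal (by linarith)) _))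
    _ ≤ 1 + 1 := by
        rw [Finset.sum_add_distrib]
        exact add_le_add h.le ((hφ.sum_error_lt s).le.trans (by simp))
    _ = 1 * 2 := by norm_num

theorem equivalentSequences (hφ : IsPotentialPerturbation q φ ε) (hP : 0 < lowerExponent P μ)
    (hq : 0 < q) {x : ℕ → VarLp 𝕜 P μ} (hx : DisjointlySupported x)
    (hmod : ∀ n (b : 𝕜) t, scaledModular μ (b • x n) t = φ n (‖b‖ₑ / ENNReal.ofReal t)) :
    EquivalentSequences 𝕜 x (unitVector 𝕜 q) := by
  have hsum : ∀ (a : ℕ →₀ 𝕜) (t : ℝ), scaledModular μ (a.sum fun n b => b • x n) t =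
      ∑ n ∈ a.support, φ n (‖a n‖ₑ / ENNReal.ofReal t) := fun a t => by
    rw [Finsupp.sum, (hx.smul a).scaledModular_sum .rfl]
    exact Finset.sum_congr rfl fun n _ => hmod n (a n) t
  have hK : (0 : ℝ) < 2 * 2 ^ q.toReal⁻¹ := by positivity
  refine ⟨(2 * 2 ^ q.toReal⁻¹)⁻¹, 2 * 2 ^ q.toReal⁻¹, inv_pos.2 hK, hK, fun a => ⟨?_, ?_⟩⟩
  · refine le_of_forall_gt_imp_ge_of_dense fun t ht => (inv_mul_le_iff₀ hK).2 ?_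
    have hlt := scaledModular_lt_one_of_norm_lt hP ht
    rw [hsum] at hlt
    rw [mul_right_comm]
    exact hφ.norm_le_of_sum_lt_one hq (ENNReal.toReal_nonneg.trans_lt ht) hlt
  · refine (div_le_iff₀' hK).1 (le_of_forall_gt_imp_ge_of_dense fun t ht => (div_le_iff₀' hK).2 ?_)
    have ht0 : 0 < t := (lp.norm_nonneg' _).trans_lt ht
    rw [mul_right_comm]
    exact norm_le_of_scaledModular_lt_one (by positivity)
      ((hsum a _).trans_lt (hφ.sum_lt_one hq ht0 ht.le))

end IsPotentialPerturbation

theorem isPotentialPerturbation_setLAverage {ε : ℕ → ℝ≥0∞} {E : ℕ → Set Ω}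
    (hE : ∀ n, MeasurableSet (E n)) (hE0 : ∀ n, μ (E n) ≠ 0) (hfin : ∀ n, μ (E n) ≠ ∞)
    (hclose : ∀ n, ∀ ω ∈ E n, ∀ y ≤ (1 / 2 : ℝ≥0∞),
      potential (P.toFun ω) y ≤ potential q y + ε n ∧
        potential q y ≤ potential (P.toFun ω) y + ε n)
    (hε : ∑' n, ε n < 1 / 2) :
    IsPotentialPerturbation q (fun n y => ⨍⁻ ω in E n, potential (P.toFun ω) y ∂μ) ε where
  mono n _ _ hyz := by
    simp only [setLAverage_eq]
    gcongr with ω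
    exact potential_mono _ hyz
  one_le n y hy := le_setLAverage (hE n) (hE0 n) (hfin n) fun ω _ => by
    by_contra! hlt
    have := (potential_le_iff (P.pos ω) ENNReal.one_ne_top).1 hlt.le
    rw [ENNReal.one_rpow] at this
    exact this.not_gt hy
  le_add n y hy := setLAverage_le (hE n) fun ω hω => (hclose n ω hω y hy).1
  potential_le_add n y hy := tsub_le_iff_right.1 <|
    le_setLAverage (hE n) (hE0 n) (hfin n) fun ω hω =>
      tsub_le_iff_right.2 (hclose n ω hω y hy).2
  tsum_lt := hε

theorem exists_measurableSet_subset_preimage_of_mem_essentialRange (h : q ∈ essentialRange P μ)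
    {U : Set ℝ≥0∞} (hU : U ∈ 𝓝 q) :
    ∃ G ⊆ P.toFun ⁻¹' U, MeasurableSet G ∧ 0 < μ G := by
  refine ⟨P.toFun ⁻¹' interior U, Set.preimage_mono interior_subset,
    P.measurable isOpen_interior.measurableSet, ?_⟩
  rw [← Measure.map_apply P.measurable isOpen_interior.measurableSet]
  exact (Measure.mem_support_iff_forall q).1 h _ (interior_mem_nhds.2 hU)

theorem exists_equivalentSequences_of_mem_essentialRange (hP : 0 < lowerExponent P μ)
    (hq : 0 < q) (hμ : IsNonatomic μ) (hμ' : IsSemifinite μ) (h : q ∈ essentialRange P μ) :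
    ∃ x : ℕ → VarLp 𝕜 P μ, DisjointlySupported x ∧
      EquivalentSequences 𝕜 x (unitVector 𝕜 q) := by
  obtain ⟨ε, hε0, hε⟩ := ENNReal.exists_pos_sum_of_countable' (ε := 1 / 2) (by simp) ℕ
  choose G hGclose hG hG0 using fun n =>
    exists_measurableSet_subset_preimage_of_mem_essentialRange h
      (eventually_potential_le_add hq (hε0 n).ne')
  obtain ⟨E, hE, hdisj⟩ := hμ.exists_pairwise_disjoint hμ' hG hG0
  choose hEG hEm hE0 hfin using hE
  have hperturb := isPotentialPerturbation_setLAverage (P := P) (q := q) hEm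
    (fun n => (hE0 n).ne') (fun n => (hfin n).ne) (fun n ω hω => hGclose n (hEG n hω)) hε
  have hx := disjointlySupported_normalizedIndicatorLp (𝕜 := 𝕜) (P := P) hEm
    (fun n => (hE0 n).ne') (fun n => (hfin n).ne) hdisj
  exact ⟨_, hx, hperturb.equivalentSequences hP hq hx fun n b t =>
    scaledModular_smul_normalizedIndicatorLp (hEm n) (hE0 n).ne' (hfin n).ne b t⟩

end Sufficiency

end VarLebesgue

open VarLebesgue in
theorem mainTheorem10_general {𝕜 : Type*} [RCLike 𝕜] {Ω : Type*} [MeasurableSpace Ω]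
    (μ : Measure Ω) (P : VariableExponent Ω) (hP : 0 < lowerExponent P μ) (q : ℝ≥0∞)
    (hq : 0 < q) :
    ((∃ x : ℕ → VarLp 𝕜 P μ, DisjointlySupported x ∧
        EquivalentSequences 𝕜 x (unitVector 𝕜 q)) → q ∈ essentialRange P μ) ∧
    (IsNonatomic μ → IsSemifinite μ →
      ((∃ x : ℕ → VarLp 𝕜 P μ, DisjointlySupported x ∧
          EquivalentSequences 𝕜 x (unitVector 𝕜 q)) ↔ q ∈ essentialRange P μ)) := by
  have hnecessary : (∃ x : ℕ → VarLp 𝕜 P μ, DisjointlySupported x ∧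
      EquivalentSequences 𝕜 x (unitVector 𝕜 q)) → q ∈ essentialRange P μ :=
    fun ⟨_, hx, h⟩ => mem_essentialRange_of_equivalentSequences hP hq hx h
  exact ⟨hnecessary, fun hμ hμ' =>
    ⟨hnecessary, exists_equivalentSequences_of_mem_essentialRange hP hq hμ hμ'⟩⟩

theorem mainTheorem10 {𝕜 : Type*} [RCLike 𝕜] {Ω : Type*} [MeasurableSpace Ω]
    (μ : MeasureTheory.Measure Ω) [MeasureTheory.SigmaFinite μ]
    (P : VarLebesgue.VariableExponent Ω) (hP : 0 < VarLebesgue.lowerExponent P μ)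
    (q : ℝ≥0∞) (hq : 0 < q) :
    ((∃ x : ℕ → VarLebesgue.VarLp 𝕜 P μ, VarLebesgue.DisjointlySupported x ∧
        VarLebesgue.EquivalentSequences 𝕜 x (VarLebesgue.unitVector 𝕜 q)) →
      q ∈ VarLebesgue.essentialRange P μ) ∧
    (VarLebesgue.IsNonatomic μ →
      ((∃ x : ℕ → VarLebesgue.VarLp 𝕜 P μ, VarLebesgue.DisjointlySupported x ∧
          VarLebesgue.EquivalentSequences 𝕜 x (VarLebesgue.unitVector 𝕜 q)) ↔
        q ∈ VarLebesgue.essentialRange P μ)) :=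
  have ⟨hnecessary, hiff⟩ := mainTheorem10_general (𝕜 := 𝕜) μ P hP q hq
  ⟨hnecessary, fun hμ => hiff hμ (VarLebesgue.isSemifinite_of_sigmaFinite μ)⟩
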